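/- Let $X$ and $Y$ be independent standard exponential random variables (each with density $e^{-x}\mathbf 1_{x>0}$). Let $q\ge 0$ be a real number and let $a,b\ge 0$ be real numbers with $a^2+b^2=1$. Then $(aX+bY)^q$, $\big(\tfrac{X+Y}{\sqrt2}\big)^q$ and $X^q$ are integrable, and $$\mathbb{E}(aX+bY)^q\;\ge\;\min\left\{\mathbb{E}\left(\frac{X+Y}{\sqrt2}\right)^q,\ \mathbb{E}X^q\right\}.$$ -/

import Mathlib

open MeasureTheory ProbabilityTheory

/-! For `a > b > 0` the variable `aX + bY` has density `(e^{-z/a} - e^{-z/b}) / (a - b)`, so with `p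
= q + 1` its moment is `Γ(p) (a^p - b^p) / (a - b)`. The claim becomes `a^p - b^p ≥ min (p
2^{-(p-1)/2}) 1 * (a - b)`, which is `min_mul_sub_le_rpow_sub`.

Everything reduces to the critical exponent `p₀` at which the two terms of the minimum coincide
(`exists_eq_two_rpow`). There, with `x = a²`, the difference of the two sides vanishes at `x = 1/2`
and at `x = 1`, and a sign argument on successive derivatives excludes negative values
(`rpow_sub_reflect_le`). Smaller `p` follow by convexity in the exponent between `1` and `p₀`
(`sub_le_rpow_sub_of_le`), larger `p` by Bernoulli's inequality (`mul_sub_le_rpow_sub_of_le`). -/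

/-! ### The inequality at the critical exponent -/

/-- If `f` is nonnegative at `l` and its derivative stays negative once it is negative, then `f`
stays negative once it is negative. -/
theorem neg_of_neg_of_hasDerivAt {f f' : ℝ → ℝ} {l r : ℝ} (hl : 0 ≤ f l)
    (hc : ContinuousOn f (Set.Icc l r)) (hd : ∀ x ∈ Set.Ioo l r, HasDerivAt f (f' x) x)
    (hf' : ∀ x y, l < x → x < y → y < r → f' x < 0 → f' y < 0)
    {x y : ℝ} (hlx : l < x) (hxy : x < y) (hyr : y ≤ r) (hx : f x < 0) : f y < 0 := by
  obtain ⟨z, hz, hz'⟩ := exists_hasDerivAt_eq_slope f f' hlx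
    (hc.mono (Set.Icc_subset_Icc le_rfl (hxy.le.trans hyr)))
    (fun t ht => hd t ⟨ht.1, ht.2.trans (hxy.trans_le hyr)⟩)
  have hneg : f' z < 0 := by
    rw [hz']
    exact div_neg_of_neg_of_pos (by linarith) (by linarith)
  obtain ⟨w, hw, hw'⟩ := exists_hasDerivAt_eq_slope f f' hxy
    (hc.mono (Set.Icc_subset_Icc hlx.le hyr))
    (fun t ht => hd t ⟨hlx.trans ht.1, ht.2.trans_le hyr⟩)
  have hw0 : f' w < 0 := hf' z w hz.1 (hz.2.trans hw.1) (hw.2.trans_le hyr) hneg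
  rw [hw', div_lt_iff₀ (by linarith)] at hw0
  linarith

theorem hasDerivAt_rpow_sub_reflect (k : ℝ) {x : ℝ} (h0 : 0 < x) (h1 : x < 1) :
    HasDerivAt (fun x : ℝ => x ^ k - (1 - x) ^ k)
      (k * (x ^ (k - 1) + (1 - x) ^ (k - 1))) x := by
  have h := (Real.hasDerivAt_rpow_const (p := k) (Or.inl h0.ne')).sub
    (((hasDerivAt_id x).const_sub 1).rpow_const (p := k) (Or.inl (sub_pos.2 h1).ne'))
  refine h.congr_deriv ?_
  simp only [id]
  ring

theorem hasDerivAt_rpow_add_reflect (k : ℝ) {x : ℝ} (h0 : 0 < x) (h1 : x < 1) :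
    HasDerivAt (fun x : ℝ => x ^ k + (1 - x) ^ k)
      (k * (x ^ (k - 1) - (1 - x) ^ (k - 1))) x := by
  have h := (Real.hasDerivAt_rpow_const (p := k) (Or.inl h0.ne')).add
    (((hasDerivAt_id x).const_sub 1).rpow_const (p := k) (Or.inl (sub_pos.2 h1).ne'))
  refine h.congr_deriv ?_
  simp only [id]
  ring

theorem rpow_sub_reflect_neg {k : ℝ} (hk : k < 0) {x : ℝ} (h : 1 / 2 < x) (h1 : x < 1) :
    x ^ k - (1 - x) ^ k < 0 :=
  sub_neg.2 (Real.rpow_lt_rpow_of_neg (by linarith) (by linarith) hk)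

/-- The comparison `φ (1 - x) ≤ φ x` on `[1/2, 1]` for `φ x = x ^ m - √x`, when `1 / 2` is the
critical point of `φ`. -/
theorem rpow_sub_reflect_le {m : ℝ} (hm3 : 3 ≤ m) (hm4 : m < 4)
    (hm : 2 * m * (1 / 2 : ℝ) ^ (m - 1) = (1 / 2 : ℝ) ^ (-(1 / 2) : ℝ)) {x : ℝ}
    (hx : 1 / 2 < x) (hx1 : x < 1) :
    x ^ (1 / 2 : ℝ) - (1 - x) ^ (1 / 2 : ℝ) ≤ x ^ m - (1 - x) ^ m := by
  -- A negative value of the difference would persist up to `1`, where the difference is `0`.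
  by_contra! hlt
  -- Negativity of the third derivative persists because it is antitone; this is where `3 ≤ m < 4`
  -- is used.
  have h3 : ∀ x y : ℝ, 1 / 2 < x → x < y → y < 1 →
      m * (m - 1) * (m - 2) * (x ^ (m - 3) + (1 - x) ^ (m - 3)) -
        3 / 8 * (x ^ (-(5 / 2) : ℝ) + (1 - x) ^ (-(5 / 2) : ℝ)) < 0 →
      m * (m - 1) * (m - 2) * (y ^ (m - 3) + (1 - y) ^ (m - 3)) -
        3 / 8 * (y ^ (-(5 / 2) : ℝ) + (1 - y) ^ (-(5 / 2) : ℝ)) < 0 := by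
    intro x y h2 hxy hy hneg
    refine lt_of_le_of_lt ?_ hneg
    have hanti : AntitoneOn (fun x : ℝ => m * (m - 1) * (m - 2) * (x ^ (m - 3) + (1 - x) ^ (m - 3)) -
        3 / 8 * (x ^ (-(5 / 2) : ℝ) + (1 - x) ^ (-(5 / 2) : ℝ))) (Set.Ioo (1 / 2) 1) := by
      have hd : ∀ x ∈ Set.Ioo (1 / 2 : ℝ) 1, HasDerivAt (fun x : ℝ =>
          m * (m - 1) * (m - 2) * (x ^ (m - 3) + (1 - x) ^ (m - 3)) -
          3 / 8 * (x ^ (-(5 / 2) : ℝ) + (1 - x) ^ (-(5 / 2) : ℝ)))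
          (m * (m - 1) * (m - 2) * ((m - 3) * (x ^ (m - 3 - 1) - (1 - x) ^ (m - 3 - 1))) -
          3 / 8 * (-(5 / 2) * (x ^ (-(5 / 2) - 1 : ℝ) - (1 - x) ^ (-(5 / 2) - 1 : ℝ)))) x := by
        intro x hx
        have h0 : 0 < x := by linarith [hx.1]
        exact ((hasDerivAt_rpow_add_reflect (m - 3) h0 hx.2).const_mul _).sub
          ((hasDerivAt_rpow_add_reflect _ h0 hx.2).const_mul _)
      refine antitoneOn_of_hasDerivWithinAt_nonpos (convex_Ioo _ _)
        (fun x hx => (hd x hx).continuousAt.continuousWithinAt)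
        (fun x hx => (hd x (interior_subset hx)).hasDerivWithinAt) ?_
      intro x hx
      have hx := interior_subset hx
      have e1 := rpow_sub_reflect_neg (k := m - 3 - 1) (by linarith) hx.1 hx.2
      have e2 := rpow_sub_reflect_neg (k := -(5 / 2) - 1) (by norm_num) hx.1 hx.2
      have e3 : m * (m - 1) * (m - 2) * ((m - 3) * (x ^ (m - 3 - 1) - (1 - x) ^ (m - 3 - 1))) ≤ 0 :=
        mul_nonpos_of_nonneg_of_nonpos
          (mul_nonneg (mul_nonneg (by linarith) (by linarith)) (by linarith))
          (mul_nonpos_of_nonneg_of_nonpos (by linarith) e1.le)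
      linarith
    exact hanti ⟨h2, hxy.trans hy⟩ ⟨h2.trans hxy, hy⟩ hxy.le
  have d2 : ∀ x ∈ Set.Ico (1 / 2 : ℝ) 1, HasDerivAt (fun x : ℝ =>
      m * (m - 1) * (x ^ (m - 2) - (1 - x) ^ (m - 2)) +
        1 / 4 * (x ^ (-(3 / 2) : ℝ) - (1 - x) ^ (-(3 / 2) : ℝ)))
      (m * (m - 1) * (m - 2) * (x ^ (m - 3) + (1 - x) ^ (m - 3)) -
        3 / 8 * (x ^ (-(5 / 2) : ℝ) + (1 - x) ^ (-(5 / 2) : ℝ))) x := by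
    intro x hx
    have h0 : 0 < x := by linarith [hx.1]
    refine (((hasDerivAt_rpow_sub_reflect (m - 2) h0 hx.2).const_mul _).add
      ((hasDerivAt_rpow_sub_reflect (-(3 / 2)) h0 hx.2).const_mul _)).congr_deriv ?_
    rw [show m - 2 - 1 = m - 3 by ring, show (-(3 / 2) - 1 : ℝ) = -(5 / 2) by norm_num]
    ring
  have d1 : ∀ x ∈ Set.Ico (1 / 2 : ℝ) 1, HasDerivAt (fun x : ℝ =>
      m * (x ^ (m - 1) + (1 - x) ^ (m - 1)) -
        1 / 2 * (x ^ (-(1 / 2) : ℝ) + (1 - x) ^ (-(1 / 2) : ℝ)))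
      (m * (m - 1) * (x ^ (m - 2) - (1 - x) ^ (m - 2)) +
        1 / 4 * (x ^ (-(3 / 2) : ℝ) - (1 - x) ^ (-(3 / 2) : ℝ))) x := by
    intro x hx
    have h0 : 0 < x := by linarith [hx.1]
    refine (((hasDerivAt_rpow_add_reflect (m - 1) h0 hx.2).const_mul _).sub
      ((hasDerivAt_rpow_add_reflect (-(1 / 2)) h0 hx.2).const_mul _)).congr_deriv ?_
    rw [show m - 1 - 1 = m - 2 by ring, show (-(1 / 2) - 1 : ℝ) = -(3 / 2) by norm_num]
    ring
  have d0 : ∀ x ∈ Set.Ico (1 / 2 : ℝ) 1, HasDerivAt (fun x : ℝ =>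
      (x ^ m - (1 - x) ^ m) - (x ^ (1 / 2 : ℝ) - (1 - x) ^ (1 / 2 : ℝ)))
      (m * (x ^ (m - 1) + (1 - x) ^ (m - 1)) -
        1 / 2 * (x ^ (-(1 / 2) : ℝ) + (1 - x) ^ (-(1 / 2) : ℝ))) x := by
    intro x hx
    have h0 : 0 < x := by linarith [hx.1]
    refine ((hasDerivAt_rpow_sub_reflect m h0 hx.2).sub
      (hasDerivAt_rpow_sub_reflect (1 / 2) h0 hx.2)).congr_deriv ?_
    rw [show (1 / 2 - 1 : ℝ) = -(1 / 2) by norm_num]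
  -- The interval stops at `y < 1` because the negative powers of `1 - x` are singular at `1`.
  have h2 := fun x y (hx : 1 / 2 < x) (hxy : x < y) (hy : y < 1) =>
    neg_of_neg_of_hasDerivAt (r := y) (x := x) (y := y) (by norm_num)
      (fun t ht => (d2 t ⟨ht.1, ht.2.trans_lt hy⟩).continuousAt.continuousWithinAt)
      (fun t ht => d2 t ⟨ht.1.le, ht.2.trans hy⟩)
      (fun s t hs hst ht => h3 s t hs hst (ht.trans hy)) hx hxy le_rfl
  have h1 := fun x y (hx : 1 / 2 < x) (hxy : x < y) (hy : y < 1) =>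
    neg_of_neg_of_hasDerivAt (r := y) (x := x) (y := y)
      (by
        -- Criticality `hm` says that the first derivative vanishes at `1/2`.
        rw [show (1 - 1 / 2 : ℝ) = 1 / 2 by norm_num]
        linarith)
      (fun t ht => (d1 t ⟨ht.1, ht.2.trans_lt hy⟩).continuousAt.continuousWithinAt)
      (fun t ht => d1 t ⟨ht.1.le, ht.2.trans hy⟩)
      (fun s t hs hst ht => h2 s t hs hst (ht.trans hy)) hx hxy le_rfl
  have h0 := neg_of_neg_of_hasDerivAt (l := 1 / 2) (r := 1) (x := x) (y := 1)
    (f := fun x : ℝ => (x ^ m - (1 - x) ^ m) - (x ^ (1 / 2 : ℝ) - (1 - x) ^ (1 / 2 : ℝ)))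
    (by norm_num)
    (by
      have c : ∀ k : ℝ, 0 ≤ k → Continuous fun x : ℝ => x ^ k - (1 - x) ^ k := fun k hk =>
        (Real.continuous_rpow_const hk).sub
          ((Real.continuous_rpow_const hk).comp (continuous_const.sub continuous_id))
      exact ((c m (by linarith)).sub (c _ (by norm_num))).continuousOn)
    (fun t ht => d0 t ⟨ht.1.le, ht.2⟩) h1 hx hx1 le_rfl (by linarith)
  norm_num [Real.zero_rpow (show m ≠ 0 by linarith)] at h0

/-- This is the exponent with `p (1/√2)^(p-1) = 1`; the bounds put `m = p / 2` in `[3, 4)`, as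
`rpow_sub_reflect_le` requires. -/
theorem exists_eq_two_rpow : ∃ p : ℝ, 6 ≤ p ∧ p < 8 ∧ (2 : ℝ) ^ ((p - 1) / 2) = p := by
  have hc : ContinuousOn (fun p : ℝ => (2 : ℝ) ^ ((p - 1) / 2) - p) (Set.Icc 6 7) := by
    refine Continuous.continuousOn ?_
    exact ((Real.continuous_const_rpow (by norm_num)).comp (by fun_prop)).sub continuous_id
  have h6 : (2 : ℝ) ^ ((6 - 1 : ℝ) / 2) - 6 ≤ 0 := by
    have : ((2 : ℝ) ^ ((6 - 1 : ℝ) / 2)) ^ 2 = 32 := by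
      rw [← Real.rpow_natCast, ← Real.rpow_mul (by norm_num)]
      norm_num
    nlinarith
  have h7 : 0 ≤ (2 : ℝ) ^ ((7 - 1 : ℝ) / 2) - 7 := by
    rw [show ((7 - 1 : ℝ) / 2) = (3 : ℕ) by norm_num, Real.rpow_natCast]
    norm_num
  obtain ⟨p, hp, h⟩ := intermediate_value_Icc (by norm_num) hc ⟨h6, h7⟩
  exact ⟨p, hp.1, hp.2.trans_lt (by norm_num), sub_eq_zero.1 h⟩

theorem sub_le_rpow_sub_of_critical {p a b : ℝ} (h6 : 6 ≤ p) (h8 : p < 8)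
    (hp : (2 : ℝ) ^ ((p - 1) / 2) = p) (hb : 0 < b) (hba : b < a) (hab : a ^ 2 + b ^ 2 = 1) :
    a - b ≤ a ^ p - b ^ p := by
  have ha : 0 < a := hb.trans hba
  have key := rpow_sub_reflect_le (m := p / 2) (x := a ^ 2) (by linarith) (by linarith) ?_
    (by nlinarith) (by nlinarith)
  · have e : (1 - a ^ 2) = b ^ 2 := by linarith
    have c : ∀ c : ℝ, 0 ≤ c → ∀ k : ℝ, (c ^ 2) ^ (k / 2) = c ^ k := fun c hc k => by
      rw [← Real.rpow_natCast, ← Real.rpow_mul hc]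
      congr 1
      push_cast
      ring
    rwa [e, c a ha.le, c b hb.le, c a ha.le, c b hb.le, Real.rpow_one, Real.rpow_one] at key
  · rw [show 2 * (p / 2) = p by ring, one_div, Real.inv_rpow (by norm_num),
      Real.inv_rpow (by norm_num), ← Real.rpow_neg (by norm_num), ← Real.rpow_neg (by norm_num)]
    nth_rewrite 1 [← hp]
    rw [← Real.rpow_add (by norm_num)]
    congr 1
    ring

/-! ### Passage to all exponents -/

/-- After division by `a^t` the inequality bounds by `1` a convex function of `t`, which equals `1`
at `t = 1`; so it holds between `1` and any `p₀` where it holds. -/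
theorem sub_le_rpow_sub_of_le {p₀ p a b : ℝ} (h1 : 1 ≤ p) (hp : p ≤ p₀) (hb : 0 < b) (hba : b < a)
    (h₀ : a - b ≤ a ^ p₀ - b ^ p₀) : a - b ≤ a ^ p - b ^ p := by
  have ha : 0 < a := hb.trans hba
  have hconc : ConvexOn ℝ Set.univ fun t : ℝ => (b / a) ^ t + (a - b) * a⁻¹ ^ t :=
    (convexOn_rpow_left (by positivity)).add
      ((convexOn_rpow_left (by positivity)).smul (sub_nonneg.2 hba.le))
  have hiff : ∀ t : ℝ, (a - b ≤ a ^ t - b ^ t ↔ (b / a) ^ t + (a - b) * a⁻¹ ^ t ≤ 1) := fun t => by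
    have hat : 0 < a ^ t := Real.rpow_pos_of_pos ha t
    rw [Real.div_rpow hb.le ha.le, Real.inv_rpow ha.le, ← div_eq_mul_inv, ← add_div,
      div_le_one hat]
    constructor <;> intro h <;> linarith
  rw [hiff] at h₀ ⊢
  have hone := (hiff 1).1 (by simp)
  exact (hconc.le_max_of_mem_Icc (Set.mem_univ 1) (Set.mem_univ p₀) ⟨h1, hp⟩).trans (max_le hone h₀)

/-- For `β < α`, the hypothesis says that `t^(p₀-1)` has mean at least `1` on `[β, α]`. Bernoulli
bounds `t^(p-1) = (t^(p₀-1))^s` below by `1 + s (t^(p₀-1) - 1)`, whose mean is then also at least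
`1`. -/
theorem mul_sub_le_rpow_sub_of_le {p₀ p α β : ℝ} (h1 : 1 < p₀) (hp : p₀ ≤ p) (hβ : 0 ≤ β)
    (hβα : β ≤ α) (h₀ : p₀ * (α - β) ≤ α ^ p₀ - β ^ p₀) : p * (α - β) ≤ α ^ p - β ^ p := by
  have hint : ∀ r : ℝ, 1 ≤ r → ∫ t in β..α, t ^ (r - 1) = (α ^ r - β ^ r) / r := fun r hr => by
    rw [integral_rpow (Or.inl (by linarith)), sub_add_cancel]
  have hi : ∀ r : ℝ, 1 ≤ r → IntervalIntegrable (fun t : ℝ => t ^ (r - 1)) volume β α :=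
    fun r hr => (Real.continuous_rpow_const (by linarith)).intervalIntegrable _ _
  set s := (p - 1) / (p₀ - 1) with hs
  have hs1 : 1 ≤ s := (one_le_div (by linarith)).2 (by linarith)
  have hle : ∫ t in β..α, (1 + s * (t ^ (p₀ - 1) - 1)) ≤ ∫ t in β..α, t ^ (p - 1) := by
    refine intervalIntegral.integral_mono_on hβα
      (intervalIntegrable_const.add (((hi p₀ h1.le).sub intervalIntegrable_const).const_mul _))
      (hi p (by linarith)) fun t ht => ?_
    have ht0 : 0 ≤ t := hβ.trans ht.1
    have := one_add_mul_self_le_rpow_one_add (s := t ^ (p₀ - 1) - 1)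
      (by linarith [Real.rpow_nonneg ht0 (p₀ - 1)]) hs1
    rwa [add_sub_cancel, ← Real.rpow_mul ht0, hs, mul_div_cancel₀ _ (by linarith)] at this
  rw [intervalIntegral.integral_add intervalIntegrable_const
      (((hi p₀ h1.le).sub intervalIntegrable_const).const_mul _),
    intervalIntegral.integral_const_mul, intervalIntegral.integral_sub (hi p₀ h1.le)
      intervalIntegrable_const, hint p₀ h1.le, hint p (by linarith)] at hle
  simp only [intervalIntegral.integral_const, smul_eq_mul, mul_one] at hle
  have h2 : α - β ≤ (α ^ p₀ - β ^ p₀) / p₀ := by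
    rw [le_div_iff₀ (by linarith)]
    linarith
  have h3 : α - β ≤ (α ^ p - β ^ p) / p := by
    nlinarith [mul_nonneg (zero_le_one.trans hs1) (sub_nonneg.2 h2)]
  rw [le_div_iff₀ (by linarith)] at h3
  linarith

theorem min_mul_sub_le_rpow_sub {p a b : ℝ} (h1 : 1 ≤ p) (hb : 0 < b) (hba : b < a)
    (hab : a ^ 2 + b ^ 2 = 1) :
    min (p * (1 / √2) ^ (p - 1)) 1 * (a - b) ≤ a ^ p - b ^ p := by
  obtain ⟨p₀, h6, h8, hp₀⟩ := exists_eq_two_rpow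
  have ha : 0 < a := hb.trans hba
  have hcrit := sub_le_rpow_sub_of_critical h6 h8 hp₀ hb hba hab
  rcases le_total p p₀ with hp | hp
  · have := sub_le_rpow_sub_of_le h1 hp hb hba hcrit
    nlinarith [min_le_right (p * (1 / √2) ^ (p - 1)) 1]
  · have hsq : (0 : ℝ) < √2 := by positivity
    have hpow : √2 ^ (p₀ - 1) = p₀ := by
      rw [Real.sqrt_eq_rpow, ← Real.rpow_mul (by norm_num)]
      rw [← hp₀]
      congr 1
      rw [hp₀]
      ring
    have hpow' : ∀ r : ℝ, √2 ^ r = √2 ^ (r - 1) * √2 := fun r => by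
      rw [Real.rpow_sub_one hsq.ne', div_mul_cancel₀ _ hsq.ne']
    -- Scaling by `√2` absorbs the factor `(1/√2)^(p-1)`; since `√2^p₀ = p₀ √2`, `hcrit` becomes the
    -- required hypothesis.
    have h := mul_sub_le_rpow_sub_of_le (p₀ := p₀) (p := p) (α := √2 * a) (β := √2 * b)
      (by linarith) hp (by positivity) (by gcongr) (by
        rw [Real.mul_rpow hsq.le ha.le, Real.mul_rpow hsq.le hb.le, hpow', hpow]
        have := mul_le_mul_of_nonneg_left hcrit (show 0 ≤ p₀ * √2 by positivity)
        linarith)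
    rw [Real.mul_rpow hsq.le ha.le, Real.mul_rpow hsq.le hb.le, hpow'] at h
    have hpos : 0 < √2 ^ (p - 1) := Real.rpow_pos_of_pos hsq _
    have h' : p * (a - b) ≤ √2 ^ (p - 1) * (a ^ p - b ^ p) := by
      refine le_of_mul_le_mul_left ?_ hsq
      linarith
    calc _ ≤ p * (1 / √2) ^ (p - 1) * (a - b) :=
          mul_le_mul_of_nonneg_right (min_le_left _ _) (by linarith)
      _ = p * (a - b) / √2 ^ (p - 1) := by
          rw [Real.div_rpow zero_le_one hsq.le, Real.one_rpow]
          ring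
      _ ≤ _ := by
          rw [div_le_iff₀ hpos]
          linarith

/-! ### Integrals against the exponential law and its convolutions -/

theorem lintegral_expMeasure_one {f : ℝ → ENNReal} (hf : Measurable f) :
    ∫⁻ x, f x ∂expMeasure 1 = ∫⁻ x in Set.Ioi 0, ENNReal.ofReal (Real.exp (-x)) * f x := by
  have hm : Measurable (gammaPDF 1 1) := (measurable_gammaPDFReal 1 1).ennreal_ofReal
  rw [expMeasure, gammaMeasure, lintegral_withDensity_eq_lintegral_mul _ hm hf,
    setLIntegral_congr Ioi_ae_eq_Ici, ← lintegral_indicator measurableSet_Ici]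
  congr 1 with x
  by_cases hx : 0 ≤ x
  · rw [Set.indicator_of_mem (Set.mem_Ici.2 hx), Pi.mul_apply, gammaPDF_of_nonneg hx]
    simp
  · rw [Set.indicator_of_notMem (by simpa using hx), Pi.mul_apply, gammaPDF_of_neg (not_le.1 hx),
      zero_mul]

theorem ae_pos_expMeasure_one : ∀ᵐ x ∂expMeasure 1, 0 < x := by
  rw [ae_iff, ← lintegral_indicator_one (by measurability),
    lintegral_expMeasure_one (measurable_one.indicator (by measurability))]
  refine (setLIntegral_congr_fun (g := 0) measurableSet_Ioi fun x hx => ?_).trans (by simp)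
  simp [Set.mem_Ioi.1 hx]

theorem lintegral_comp_affine_Ioi {b : ℝ} (hb : 0 < b) (c : ℝ) (g : ℝ → ENNReal) :
    ∫⁻ y in Set.Ioi 0, ENNReal.ofReal (Real.exp (-y)) * g (c + b * y) =
      ∫⁻ z in Set.Ioi c, ENNReal.ofReal (Real.exp (-((z - c) / b)) / b) * g z := by
  have himg : (fun y => c + b * y) '' Set.Ioi 0 = Set.Ioi c := by
    ext z
    simp only [Set.mem_image, Set.mem_Ioi]
    constructor
    · rintro ⟨y, hy, rfl⟩
      have := mul_pos hb hy
      linarith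
    · exact fun hz => ⟨(z - c) / b, div_pos (sub_pos.2 hz) hb, by field_simp; ring⟩
  rw [← himg, lintegral_image_eq_lintegral_abs_deriv_mul (f' := fun _ => b) measurableSet_Ioi
    (fun x _ => by simpa using (((hasDerivAt_id x).const_mul b).const_add c).hasDerivWithinAt)
    (fun x _ y _ h => by simpa [hb.ne'] using h)]
  refine setLIntegral_congr_fun measurableSet_Ioi fun y _ => ?_
  rw [← mul_assoc, ← ENNReal.ofReal_mul (abs_nonneg b), abs_of_pos hb]
  rw [add_sub_cancel_left, mul_div_cancel_left₀ _ hb.ne', mul_div_cancel₀ _ hb.ne']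

/-- The density of `a X + b Y` for independent standard exponential `X` and `Y`. -/
theorem lintegral_lintegral_expMeasure_one {a b : ℝ} (ha : 0 < a) (hb : 0 < b) {g : ℝ → ENNReal}
    (hg : Measurable g) :
    ∫⁻ x, ∫⁻ y, g (a * x + b * y) ∂expMeasure 1 ∂expMeasure 1 =
      ∫⁻ z in Set.Ioi 0, (ENNReal.ofReal (Real.exp (-(z / b)) / b) *
        ∫⁻ x in Set.Ioo 0 (z / a), ENNReal.ofReal (Real.exp ((a / b - 1) * x))) * g z := by
  have : IsProbabilityMeasure (expMeasure 1) := isProbabilityMeasure_expMeasure one_pos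
  set K : ℝ → ℝ → ENNReal := fun x z => ENNReal.ofReal (Real.exp (-(z / b)) / b) *
    ENNReal.ofReal (Real.exp ((a / b - 1) * x)) * g z with hK
  have hKm : Measurable (Function.uncurry K) := by
    simp only [hK, Function.uncurry_def]
    fun_prop
  -- The image of the open quadrant under `(x, y) ↦ (x, a x + b y)`; Tonelli then exchanges the
  -- order of integration over it.
  set S : Set (ℝ × ℝ) := {p | 0 < p.1 ∧ a * p.1 < p.2} with hS
  have hSm : MeasurableSet S := (measurableSet_lt measurable_const measurable_fst).inter
    (measurableSet_lt (measurable_fst.const_mul a) measurable_snd)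
  calc _ = ∫⁻ x in Set.Ioi 0, ENNReal.ofReal (Real.exp (-x)) *
        ∫⁻ z in Set.Ioi (a * x), ENNReal.ofReal (Real.exp (-((z - a * x) / b)) / b) * g z := by
        rw [lintegral_expMeasure_one (Measurable.lintegral_prod_right'
          (f := fun p : ℝ × ℝ => g (a * p.1 + b * p.2)) (hg.comp (by fun_prop)))]
        refine setLIntegral_congr_fun measurableSet_Ioi fun x _ => ?_
        simp only
        rw [lintegral_expMeasure_one (f := fun y => g (a * x + b * y)) (by fun_prop), lintegral_comp_affine_Ioi hb]
    _ = ∫⁻ x, ∫⁻ z, S.indicator (Function.uncurry K) (x, z) := by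
        rw [← lintegral_indicator measurableSet_Ioi]
        congr 1 with x
        by_cases hx : 0 < x
        · rw [Set.indicator_of_mem (Set.mem_Ioi.2 hx),
            ← lintegral_const_mul _ (by fun_prop),
            ← lintegral_indicator measurableSet_Ioi]
          congr 1 with z
          simp only [Set.indicator, Set.mem_Ioi, hS, Set.mem_ofPred_eq, hx, true_and]
          split_ifs with h
          · simp only [Function.uncurry, hK]
            rw [← mul_assoc, ← ENNReal.ofReal_mul (by positivity),
              ← ENNReal.ofReal_mul (by positivity), mul_div_assoc', div_mul_eq_mul_div,
              ← Real.exp_add, ← Real.exp_add]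
            congr 4
            field_simp
            ring
          · rfl
        · rw [Set.indicator_of_notMem (by simpa using hx)]
          simp [Set.indicator, hS, hx]
    _ = ∫⁻ z, ∫⁻ x, S.indicator (Function.uncurry K) (x, z) :=
        lintegral_lintegral_swap (hKm.indicator hSm).aemeasurable
    _ = _ := by
        rw [← lintegral_indicator measurableSet_Ioi]
        congr 1 with z
        by_cases hz : 0 < z
        · rw [Set.indicator_of_mem (Set.mem_Ioi.2 hz),
            ← lintegral_const_mul _ (Measurable.ennreal_ofReal (by fun_prop)),
            ← lintegral_mul_const _ ((Measurable.ennreal_ofReal (by fun_prop)).const_mul _),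
            ← lintegral_indicator measurableSet_Ioo]
          congr 1 with x
          simp only [Set.indicator, Set.mem_Ioo, hS, Set.mem_ofPred_eq, lt_div_iff₀' ha]
          rfl
        · rw [Set.indicator_of_notMem (by simpa using hz)]
          have : ∀ x, (x, z) ∉ S := fun x hx => hz ((mul_pos ha hx.1).trans hx.2)
          simp [Set.indicator, this]

theorem lintegral_Ioo_exp_mul {k c : ℝ} (hk : k ≠ 0) (hc : 0 ≤ c) :
    ∫⁻ x in Set.Ioo 0 c, ENNReal.ofReal (Real.exp (k * x)) =
      ENNReal.ofReal ((Real.exp (k * c) - 1) / k) := by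
  rw [← ofReal_integral_eq_lintegral_ofReal _ (ae_of_all _ fun x => (Real.exp_pos _).le),
    ← integral_Ioc_eq_integral_Ioo, ← intervalIntegral.integral_of_le hc,
    intervalIntegral.integral_comp_mul_left (fun x => Real.exp x) hk]
  · simp [integral_exp, div_eq_inv_mul]
  · rw [← IntegrableOn, ← intervalIntegrable_iff_integrableOn_Ioo_of_le hc]
    exact Continuous.intervalIntegrable (by fun_prop) _ _

theorem integrableOn_rpow_mul_exp_neg_mul {s r : ℝ} (hs : -1 < s) (hr : 0 < r) :
    IntegrableOn (fun t : ℝ => t ^ s * Real.exp (-(r * t))) (Set.Ioi 0) := by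
  simpa [neg_mul] using integrableOn_rpow_mul_exp_neg_mul_rpow hs one_pos hr

theorem lintegral_rpow_mul_exp_neg_mul {s r : ℝ} (hs : -1 < s) (hr : 0 < r) :
    ∫⁻ t in Set.Ioi 0, ENNReal.ofReal (t ^ s * Real.exp (-(r * t))) =
      ENNReal.ofReal ((1 / r) ^ (s + 1) * Real.Gamma (s + 1)) := by
  rw [← ofReal_integral_eq_lintegral_ofReal (integrableOn_rpow_mul_exp_neg_mul hs hr),
    ← Real.integral_rpow_mul_exp_neg_mul_Ioi (by linarith) hr, add_sub_cancel_right]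
  filter_upwards [ae_restrict_mem measurableSet_Ioi] with t ht
  have := Set.mem_Ioi.1 ht
  simp only [Pi.zero_apply]
  positivity

theorem lintegral_rpow_expMeasure_one {q : ℝ} (hq : 0 ≤ q) :
    ∫⁻ x, ENNReal.ofReal (x ^ q) ∂expMeasure 1 = ENNReal.ofReal (Real.Gamma (q + 1)) := by
  rw [lintegral_expMeasure_one (by fun_prop)]
  have := lintegral_rpow_mul_exp_neg_mul (s := q) (r := 1) (by linarith) one_pos
  simp only [one_mul, div_one, Real.one_rpow] at this
  rw [← this]
  refine setLIntegral_congr_fun measurableSet_Ioi fun x _ => ?_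
  rw [← ENNReal.ofReal_mul (Real.exp_pos _).le, mul_comm]

/-- With equal weights the exponentials in the inner integral cancel, leaving the Gamma density `z
e^{-z/a} / a²`. -/
theorem lintegral_rpow_add_of_eq {q a : ℝ} (hq : 0 ≤ q) (ha : 0 < a) :
    ∫⁻ x, ∫⁻ y, ENNReal.ofReal ((a * x + a * y) ^ q) ∂expMeasure 1 ∂expMeasure 1 =
      ENNReal.ofReal (Real.Gamma (q + 1) * ((q + 1) * a ^ q)) := by
  rw [lintegral_lintegral_expMeasure_one ha ha (g := fun z => ENNReal.ofReal (z ^ q))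
    (by fun_prop)]
  have h := lintegral_rpow_mul_exp_neg_mul (s := q + 1) (r := 1 / a) (by linarith) (by positivity)
  have e : Real.Gamma (q + 1) * ((q + 1) * a ^ q) =
      1 / a ^ 2 * ((1 / (1 / a)) ^ (q + 1 + 1) * Real.Gamma (q + 1 + 1)) := by
    rw [one_div_one_div, Real.Gamma_add_one (by linarith : q + 1 ≠ 0),
      Real.rpow_add_one ha.ne', Real.rpow_add_one ha.ne']
    field_simp
  rw [e, ENNReal.ofReal_mul (by positivity), ← h, ← lintegral_const_mul _
    (Measurable.ennreal_ofReal (by fun_prop))]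
  refine setLIntegral_congr_fun measurableSet_Ioi fun z hz => ?_
  have hz := Set.mem_Ioi.1 hz
  simp only [div_self ha.ne', sub_self, zero_mul, Real.exp_zero, ENNReal.ofReal_one,
    lintegral_const, one_mul, Measure.restrict_apply MeasurableSet.univ, Set.univ_inter,
    Real.volume_Ioo, sub_zero]
  rw [← ENNReal.ofReal_mul (by positivity), ← ENNReal.ofReal_mul (by positivity),
    ← ENNReal.ofReal_mul (by positivity), Real.rpow_add_one hz.ne']
  congr 1
  rw [one_div_mul_eq_div a z]
  field_simp

/-- The inner integral turns the density into `(e^{-z/a} - e^{-z/b}) / (a - b)`, so the moment is a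
difference of two Gamma integrals. -/
theorem lintegral_rpow_add_of_lt {q a b : ℝ} (hq : 0 ≤ q) (hb : 0 < b) (hba : b < a) :
    ∫⁻ x, ∫⁻ y, ENNReal.ofReal ((a * x + b * y) ^ q) ∂expMeasure 1 ∂expMeasure 1 =
      ENNReal.ofReal (Real.Gamma (q + 1) * ((a ^ (q + 1) - b ^ (q + 1)) / (a - b))) := by
  have ha : 0 < a := hb.trans hba
  have hsub : 0 < a - b := sub_pos.2 hba
  rw [lintegral_lintegral_expMeasure_one ha hb (g := fun z => ENNReal.ofReal (z ^ q))
    (by fun_prop)]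
  have hi : ∀ c : ℝ, 0 < c → IntegrableOn (fun t : ℝ => t ^ q * Real.exp (-(1 / c * t)))
      (Set.Ioi 0) := fun c hc =>
    integrableOn_rpow_mul_exp_neg_mul (by linarith) (by positivity)
  have hI : ∀ c : ℝ, 0 < c → ∫ t in Set.Ioi 0, t ^ q * Real.exp (-(1 / c * t)) =
      c ^ (q + 1) * Real.Gamma (q + 1) := fun c hc => by
    have := Real.integral_rpow_mul_exp_neg_mul_Ioi (a := q + 1) (r := 1 / c) (by linarith)
      (by positivity)
    rwa [add_sub_cancel_right, one_div_one_div] at this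
  have hmain : Real.Gamma (q + 1) * ((a ^ (q + 1) - b ^ (q + 1)) / (a - b)) =
      ∫ t in Set.Ioi 0, (t ^ q * Real.exp (-(1 / a * t)) - t ^ q * Real.exp (-(1 / b * t))) /
        (a - b) := by
    rw [integral_div, integral_sub (hi a ha) (hi b hb), hI a ha, hI b hb]
    ring
  have hle : ∀ t : ℝ, 0 < t → Real.exp (-(1 / b * t)) ≤ Real.exp (-(1 / a * t)) := fun t ht =>
    Real.exp_le_exp.2 (neg_le_neg (mul_le_mul_of_nonneg_right
      (one_div_le_one_div_of_le hb hba.le) ht.le))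
  rw [hmain, ofReal_integral_eq_lintegral_ofReal
    (show Integrable (fun t : ℝ => (t ^ q * Real.exp (-(1 / a * t)) -
      t ^ q * Real.exp (-(1 / b * t))) / (a - b)) (volume.restrict (Set.Ioi 0)) from
      ((hi a ha).sub (hi b hb)).div_const _)]
  · refine setLIntegral_congr_fun measurableSet_Ioi fun z hz => ?_
    have hz := Set.mem_Ioi.1 hz
    have hk : a / b - 1 ≠ 0 := by
      rw [div_sub_one hb.ne']
      exact (div_pos hsub hb).ne'
    rw [lintegral_Ioo_exp_mul hk (by positivity), ← ENNReal.ofReal_mul (by positivity),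
      ← ENNReal.ofReal_mul' (by positivity)]
    congr 1
    have e : Real.exp (-(1 / a * z)) = Real.exp (-(1 / b * z)) * Real.exp ((a / b - 1) * (z / a)) := by
      rw [← Real.exp_add]
      congr 1
      field_simp
      ring
    rw [e, div_sub_one hb.ne', one_div_mul_eq_div b z]
    field_simp
  · filter_upwards [ae_restrict_mem measurableSet_Ioi] with t ht
    have ht := Set.mem_Ioi.1 ht
    refine div_nonneg ?_ hsub.le
    rw [← mul_sub]
    exact mul_nonneg (Real.rpow_nonneg ht.le q) (sub_nonneg.2 (hle t ht))

/-! ### Moments of the random variables -/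

theorem integrable_and_integral_eq_of_lintegral {Ω : Type*} [MeasurableSpace Ω] {P : Measure Ω}
    {f : Ω → ℝ} {v : ℝ} (hf : AEMeasurable f P) (h0 : 0 ≤ᵐ[P] f) (hv : 0 ≤ v)
    (h : ∫⁻ ω, ENNReal.ofReal (f ω) ∂P = ENNReal.ofReal v) :
    Integrable f P ∧ ∫ ω, f ω ∂P = v := by
  refine ⟨⟨hf.aestronglyMeasurable, ?_⟩, ?_⟩
  · rw [hasFiniteIntegral_iff_ofReal h0, h]
    exact ENNReal.ofReal_lt_top
  · rw [integral_eq_lintegral_of_nonneg_ae h0 hf.aestronglyMeasurable, h, ENNReal.toReal_ofReal hv]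

section Moments

variable {Ω : Type*} [MeasurableSpace Ω] {P : Measure Ω} {X Y : Ω → ℝ}

theorem ae_pos_of_hasLaw_expMeasure_one (hX : HasLaw X (expMeasure 1) P) : ∀ᵐ ω ∂P, 0 < X ω :=
  (hX.ae_iff (p := fun x => 0 < x) (by measurability)).2 ae_pos_expMeasure_one

theorem moment_of_hasLaw_expMeasure_one (hX : HasLaw X (expMeasure 1) P) {q : ℝ} (hq : 0 ≤ q) :
    Integrable (fun ω => X ω ^ q) P ∧ ∫ ω, X ω ^ q ∂P = Real.Gamma (q + 1) := by
  have hm := hX.aemeasurable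
  refine integrable_and_integral_eq_of_lintegral (by fun_prop) ?_
    (Real.Gamma_pos_of_pos (by linarith)).le ?_
  · filter_upwards [ae_pos_of_hasLaw_expMeasure_one hX] with ω h
    exact Real.rpow_nonneg h.le q
  · rw [hX.lintegral_comp (f := fun x => ENNReal.ofReal (x ^ q)) (by fun_prop),
      lintegral_rpow_expMeasure_one hq]

theorem moment_add_of_lintegral [IsProbabilityMeasure P] (hX : HasLaw X (expMeasure 1) P)
    (hY : HasLaw Y (expMeasure 1) P) (hXY : IndepFun X Y P) {q a b v : ℝ} (ha : 0 ≤ a) (hb : 0 ≤ b)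
    (hv : 0 ≤ v)
    (h : ∫⁻ x, ∫⁻ y, ENNReal.ofReal ((a * x + b * y) ^ q) ∂expMeasure 1 ∂expMeasure 1 =
      ENNReal.ofReal v) :
    Integrable (fun ω => (a * X ω + b * Y ω) ^ q) P ∧ ∫ ω, (a * X ω + b * Y ω) ^ q ∂P = v := by
  have hmX := hX.aemeasurable
  have hmY := hY.aemeasurable
  have : IsProbabilityMeasure (expMeasure 1) := isProbabilityMeasure_expMeasure one_pos
  refine integrable_and_integral_eq_of_lintegral (by fun_prop) ?_ hv ?_
  · filter_upwards [ae_pos_of_hasLaw_expMeasure_one hX, ae_pos_of_hasLaw_expMeasure_one hY]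
      with ω h1 h2
    exact Real.rpow_nonneg (by positivity) q
  · rw [((indepFun_iff_hasLaw_prodMk_prod hX hY).1 hXY).lintegral_comp
      (f := fun p : ℝ × ℝ => ENNReal.ofReal ((a * p.1 + b * p.2) ^ q)) (by fun_prop),
      lintegral_prod _ (by fun_prop), h]

theorem moment_add_of_eq [IsProbabilityMeasure P] (hX : HasLaw X (expMeasure 1) P)
    (hY : HasLaw Y (expMeasure 1) P) (hXY : IndepFun X Y P) {q : ℝ} (hq : 0 ≤ q) :
    Integrable (fun ω => ((X ω + Y ω) / √2) ^ q) P ∧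
      ∫ ω, ((X ω + Y ω) / √2) ^ q ∂P = Real.Gamma (q + 1) * ((q + 1) * (1 / √2) ^ q) := by
  have hG := Real.Gamma_pos_of_pos (show 0 < q + 1 by linarith)
  have := moment_add_of_lintegral hX hY hXY (by positivity) (by positivity) (by positivity)
    (lintegral_rpow_add_of_eq hq (show 0 < 1 / √2 by positivity))
  have e : ∀ ω, 1 / √2 * X ω + 1 / √2 * Y ω = (X ω + Y ω) / √2 := fun ω => by ring
  simpa only [e] using this

theorem moment_add_of_lt [IsProbabilityMeasure P] (hX : HasLaw X (expMeasure 1) P)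
    (hY : HasLaw Y (expMeasure 1) P) (hXY : IndepFun X Y P) {q a b : ℝ} (hq : 0 ≤ q) (hb : 0 < b)
    (hba : b < a) :
    Integrable (fun ω => (a * X ω + b * Y ω) ^ q) P ∧ ∫ ω, (a * X ω + b * Y ω) ^ q ∂P =
      Real.Gamma (q + 1) * ((a ^ (q + 1) - b ^ (q + 1)) / (a - b)) := by
  have hG := Real.Gamma_pos_of_pos (show 0 < q + 1 by linarith)
  have hp : b ^ (q + 1) ≤ a ^ (q + 1) := Real.rpow_le_rpow hb.le hba.le (by linarith)
  exact moment_add_of_lintegral hX hY hXY (hb.trans hba).le hb.le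
    (mul_nonneg hG.le (div_nonneg (sub_nonneg.2 hp) (sub_nonneg.2 hba.le)))
    (lintegral_rpow_add_of_lt hq hb hba)

theorem min_le_moment_add_of_lt [IsProbabilityMeasure P] (hX : HasLaw X (expMeasure 1) P)
    (hY : HasLaw Y (expMeasure 1) P) (hXY : IndepFun X Y P) {q a b : ℝ} (hq : 0 ≤ q) (hb : 0 ≤ b)
    (hba : b < a) (hab : a ^ 2 + b ^ 2 = 1) :
    Integrable (fun ω => (a * X ω + b * Y ω) ^ q) P ∧
      min (Real.Gamma (q + 1) * ((q + 1) * (1 / √2) ^ q)) (Real.Gamma (q + 1)) ≤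
        ∫ ω, (a * X ω + b * Y ω) ^ q ∂P := by
  rcases hb.eq_or_lt with rfl | hb
  -- At `b = 0` the moment is that of `X`, the second term of the minimum.
  · obtain rfl : a = 1 := by nlinarith
    obtain ⟨hi, he⟩ := moment_of_hasLaw_expMeasure_one hX hq
    simpa [he] using hi
  · obtain ⟨hi, he⟩ := moment_add_of_lt hX hY hXY hq hb hba
    refine ⟨hi, ?_⟩
    have hG := Real.Gamma_pos_of_pos (show 0 < q + 1 by linarith)
    have h := min_mul_sub_le_rpow_sub (p := q + 1) (by linarith) hb hba hab
    rw [add_sub_cancel_right, ← le_div_iff₀ (sub_pos.2 hba)] at h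
    rw [he]
    refine le_trans (le_of_eq ?_) (mul_le_mul_of_nonneg_left h hG.le)
    rw [mul_min_of_nonneg _ _ hG.le, mul_one]

end Moments

theorem mainTheorem11 {Ω : Type*} [MeasurableSpace Ω] (P : Measure Ω) [IsProbabilityMeasure P]
    (X Y : Ω → ℝ) (hX : HasLaw X (expMeasure 1) P) (hY : HasLaw Y (expMeasure 1) P)
    (hXY : IndepFun X Y P)
    (q a b : ℝ) (hq : 0 ≤ q) (ha : 0 ≤ a) (hb : 0 ≤ b) (hab : a ^ 2 + b ^ 2 = 1) :
    Integrable (fun ω => (a * X ω + b * Y ω) ^ q) P ∧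
    Integrable (fun ω => ((X ω + Y ω) / √2) ^ q) P ∧
    Integrable (fun ω => X ω ^ q) P ∧
    ∫ ω, (a * X ω + b * Y ω) ^ q ∂P ≥
      min (∫ ω, ((X ω + Y ω) / √2) ^ q ∂P) (∫ ω, X ω ^ q ∂P) := by
  obtain ⟨hiX, heX⟩ := moment_of_hasLaw_expMeasure_one hX hq
  obtain ⟨hiS, heS⟩ := moment_add_of_eq hX hY hXY hq
  suffices h : Integrable (fun ω => (a * X ω + b * Y ω) ^ q) P ∧
      min (∫ ω, ((X ω + Y ω) / √2) ^ q ∂P) (∫ ω, X ω ^ q ∂P) ≤ ∫ ω, (a * X ω + b * Y ω) ^ q ∂P from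
    ⟨h.1, hiS, hiX, h.2⟩
  rcases lt_trichotomy b a with hba | rfl | hba
  · rw [heX, heS]
    exact min_le_moment_add_of_lt hX hY hXY hq hb hba hab
  · have e : b = 1 / √2 := by
      rw [← Real.sqrt_sq hb, show b ^ 2 = 1 / 2 by linarith, Real.sqrt_div zero_le_one,
        Real.sqrt_one]
    have e' : ∀ ω, b * X ω + b * Y ω = (X ω + Y ω) / √2 := fun ω => by
      rw [e]
      ring
    simp only [e']
    exact ⟨hiS, min_le_left _ _⟩
  · rw [heX, heS]
    simp only [add_comm (a * X _)]
    exact min_le_moment_add_of_lt hY hX hXY.symm hq ha hba (by linarith)
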